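/- Let $M$ be a contractible open topological manifold, i.e. a contractible non-compact Hausdorff second countable space every point of which has a neighborhood homeomorphic to an open subset of $\mathbb{R}^n$, for some fixed $n$. Then the one-point compactification $(M\times[0,1))\sqcup\{\infty\}$ is a $\mathcal{Z}$-compactification of $M\times[0,1)$. Here a compactification $\widehat{X}=X\sqcup Z$ of a space $X$ (a compact Hausdorff space $\widehat X$ containing $X$ as a dense subspace) is called a $\mathcal{Z}$-compactification if, for every open set $U\subseteq\widehat{X}$, the inclusion $U\setminus Z\hookrightarrow U$ is a homotopy equivalence. -/

import Mathlib

/-- A continuous map is a homotopy equivalence if it has a continuous homotopy inverse. -/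
def IsHomotopyEquivalence {X Y : Type*} [TopologicalSpace X] [TopologicalSpace Y]
    (f : C(X, Y)) : Prop :=
  ∃ h : ContinuousMap.HomotopyEquiv X Y, h.toFun = f

/-- The map `e : X → Y` exhibits the space `Y` as a compactification of `X`: `Y` is compact
Hausdorff and `e` is a homeomorphism onto a dense subspace. -/
structure IsCompactification {X Y : Type*} [TopologicalSpace X] [TopologicalSpace Y]
    (e : X → Y) : Prop where
  compact : CompactSpace Y
  hausdorff : T2Space Y
  denseEmbedding : IsDenseEmbedding e

/-- The compactification `e : X → Y`, with remainder `Z = Y \ e(X)`, is a `𝒵`-compactification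
if for every open `U ⊆ Y` the inclusion `U \ Z ↪ U` is a homotopy equivalence.
(If `X` is locally compact, then `Z` is automatically closed in `Y`.) -/
structure IsZCompactification {X Y : Type*} [TopologicalSpace X] [TopologicalSpace Y]
    (e : X → Y) : Prop extends IsCompactification e where
  homotopyEquivalence : ∀ U : Set Y, IsOpen U →
    IsHomotopyEquivalence
      (ContinuousMap.inclusion (Set.sdiff_subset : U \ (Set.range e)ᶜ ⊆ U))

open Set Filter Topology unitInterval OnePoint

/-- A σ-compact locally compact Hausdorff space has a continuous function with values below
`1` whose sublevel sets at heights `a < 1` are compact. -/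
theorem exists_continuous_lt_one_isCompact_sublevel (M : Type*) [TopologicalSpace M] [T2Space M]
    [LocallyCompactSpace M] [SigmaCompactSpace M] :
    ∃ r : C(M, ℝ), (∀ x, r x < 1) ∧ ∀ a < 1, IsCompact {x | r x ≤ a} := by
  have hG : IsGδ ({∞} : Set (OnePoint M)) := by
    have : ({∞} : Set (OnePoint M)) = ⋂ k, ((↑) '' compactCovering M k)ᶜ := by
      rw [← compl_iUnion, ← image_iUnion, iUnion_compactCovering, image_univ, compl_range_coe]
    rw [this]
    refine .iInter_of_isOpen fun k => ?_
    exact isOpen_compl_image_coe.2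
      ⟨(isCompact_compactCovering M k).isClosed, isCompact_compactCovering M k⟩
  obtain ⟨f, hf, -, -, hf01⟩ := exists_continuous_one_zero_of_isCompact_of_isGδ
    isCompact_singleton hG isClosed_empty (disjoint_empty _)
  refine ⟨f.comp ⟨_, continuous_coe⟩, fun x => ?_, fun a ha => ?_⟩
  · refine (hf01 _).2.lt_of_ne fun h => coe_ne_infty x ?_
    have : (x : OnePoint M) ∈ f ⁻¹' {1} := h
    rwa [← hf] at this
  · rw [isOpenEmbedding_coe.isInducing.isCompact_iff]
    have : ((↑) '' {x : M | f x ≤ a} : Set (OnePoint M)) = f ⁻¹' Iic a := by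
      ext y
      induction y using OnePoint.rec with
      | infty =>
        have h1 : (∞ : OnePoint M) ∈ f ⁻¹' {1} := hf ▸ mem_singleton _
        have h2 : f ∞ = 1 := h1
        simp [h2, ha]
      | coe x => simp
    exact this ▸ (isClosed_Iic.preimage f.continuous).isCompact

theorem OnePoint.continuous_elim_one {X : Type*} [TopologicalSpace X] {h : X → ℝ}
    (hc : Continuous h) (h1 : ∀ x, h x < 1) (hK : ∀ a < 1, IsCompact {x | h x ≤ a}) :
    Continuous fun y : OnePoint X => y.elim 1 h := by
  rw [continuous_iff_continuousAt]
  intro y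
  induction y using OnePoint.rec with
  | infty =>
    rw [continuousAt_infty']
    refine tendsto_order.2 ⟨fun a ha => ?_, fun a ha => .of_forall fun x => (h1 x).trans ha⟩
    refine hasBasis_coclosedCompact.mem_iff.2
      ⟨{x | h x ≤ a}, ⟨isClosed_le hc continuous_const, hK a ha⟩, fun x hx => ?_⟩
    simpa using hx
  | coe x => exact continuousAt_coe.2 hc.continuousAt

/-- Neighbourhoods of `∞` contain superlevel sets of any function that peaks exactly at `∞`. -/
theorem OnePoint.exists_superlevel_subset {X : Type*} [TopologicalSpace X] {h : X → ℝ}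
    (h1 : ∀ x, h x < 1) (hc : Continuous fun y : OnePoint X => y.elim 1 h)
    {U : Set (OnePoint X)} (hU : IsOpen U) (hinf : ∞ ∈ U) :
    ∃ a < 1, ∀ x : X, a < h x → (x : OnePoint X) ∈ U := by
  obtain hE | hE := Uᶜ.eq_empty_or_nonempty
  · exact ⟨0, one_pos, fun x _ => by simp [compl_empty_iff.1 hE]⟩
  · obtain ⟨y, hyU, hy⟩ := hU.isClosed_compl.isCompact.exists_isMaxOn hE hc.continuousOn
    have hy' : y ≠ ∞ := fun e => hyU (e ▸ hinf)
    obtain ⟨x, rfl⟩ := ne_infty_iff_exists.1 hy'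
    refine ⟨h x, h1 x, fun z hz => ?_⟩
    by_contra hzU
    exact (hy hzU).not_gt hz

/-- Extend a homotopy of `X` to the one-point compactification, moving `∞` along `γ`. -/
noncomputable def OnePoint.extendHomotopy {X : Type*} (G : I × X → X) (γ : I → X)
    (q : I × OnePoint X) : OnePoint X :=
  q.2.elim (if q.1 = 0 then ∞ else (γ q.1 : OnePoint X)) fun x => (G (q.1, x) : OnePoint X)

theorem OnePoint.continuous_extendHomotopy {X : Type*} [TopologicalSpace X]
    {h : X → ℝ} (h1 : ∀ x, h x < 1) (hc : Continuous fun y : OnePoint X => y.elim 1 h)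
    {G : I × X → X} (hG : Continuous G) {γ : I → X} (hγ : ContinuousOn γ {t | 0 < t})
    (hGγ : ∀ (t : I) x, 0 < t → 1 - (t : ℝ) ≤ h x → G (t, x) = γ t)
    (hlow : ∀ (t : I) x, G (t, x) = x ∨ 1 - 2 * (t : ℝ) ≤ h (G (t, x)))
    (hγlow : ∀ t : I, 0 < t → 1 - 2 * (t : ℝ) ≤ h (γ t)) :
    Continuous (extendHomotopy G γ) := by
  rw [continuous_iff_continuousAt]
  rintro ⟨t, y⟩
  induction y using OnePoint.rec with
  | coe x =>
    have he : IsOpenEmbedding (Prod.map id (↑) : I × X → I × OnePoint X) :=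
      IsOpenEmbedding.id.prodMap isOpenEmbedding_coe
    refine (he.continuousAt_iff (x := (t, x))).1 ?_
    exact (continuous_coe.comp hG).continuousAt
  | infty =>
    obtain rfl | ht := eq_or_ne t 0
    · intro V hV
      have hV' : V ∈ 𝓝 (∞ : OnePoint X) := by simpa [extendHomotopy] using hV
      obtain ⟨W, hWV, hW, hWi⟩ := mem_nhds_iff.1 hV'
      obtain ⟨a, ha, haW⟩ := exists_superlevel_subset h1 hc hW hWi
      have e1 : ∀ᶠ q : I × OnePoint X in 𝓝 (0, ∞), a < q.2.elim 1 h :=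
        (hc.comp continuous_snd).continuousAt.eventually (lt_mem_nhds (by simpa using ha))
      have e2 : ∀ᶠ q : I × OnePoint X in 𝓝 (0, ∞), a < 1 - 2 * (q.1 : ℝ) :=
        Tendsto.eventually (f := fun q : I × OnePoint X => 1 - 2 * (q.1 : ℝ))
          (ContinuousAt.tendsto (by fun_prop)) (lt_mem_nhds (by simpa using ha))
      rw [mem_map]
      filter_upwards [e1, e2]
      rintro ⟨s, y⟩ hy hs
      refine hWV ?_
      induction y using OnePoint.rec with
      | infty =>
        by_cases h0 : s = 0
        · simpa [extendHomotopy, h0] using hWi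
        · simpa [extendHomotopy, h0] using
            haW _ (hs.trans_le (hγlow s (unitInterval.pos_iff_ne_zero.2 h0)))
      | coe x =>
        refine haW _ ?_
        obtain e | e := hlow s x
        · rw [e]; exact hy
        · exact hs.trans_le e
    · have htp := unitInterval.pos_iff_ne_zero.2 ht
      have hcont : ContinuousAt (fun q : I × OnePoint X => (γ q.1 : OnePoint X)) (t, ∞) := by
        have : ContinuousAt γ t := hγ.continuousAt (lt_mem_nhds htp)
        exact continuous_coe.continuousAt.comp
          (ContinuousAt.comp (f := Prod.fst) (x := ((t, ∞) : I × OnePoint X)) this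
            continuousAt_fst)
      refine hcont.congr ?_
      have e1 : ∀ᶠ q : I × OnePoint X in 𝓝 (t, ∞), 1 - (q.1 : ℝ) < q.2.elim 1 h :=
        ContinuousAt.eventually_lt (by fun_prop) (hc.comp continuous_snd).continuousAt
          (by simpa using htp)
      have e2 : ∀ᶠ q : I × OnePoint X in 𝓝 (t, ∞), 0 < q.1 :=
        continuousAt_fst.eventually (lt_mem_nhds htp)
      filter_upwards [e1, e2]
      rintro ⟨s, y⟩ hy hs
      induction y using OnePoint.rec with
      | infty => simp [extendHomotopy, (show s ≠ 0 from hs.ne')]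
      | coe x => exact congrArg _ (hGγ s x hs hy.le).symm

/-- A homotopy of `Y` starting at the identity that preserves `U` and `V ⊆ U` and moves `U`
into `V` makes `V ↪ U` a homotopy equivalence. -/
theorem isHomotopyEquivalence_inclusion_of_homotopy {Y : Type*} [TopologicalSpace Y] {U V : Set Y}
    (hVU : V ⊆ U) (K : I × Y → Y) (hK : Continuous K) (h0 : ∀ y, K (0, y) = y)
    (hU : ∀ t, ∀ y ∈ U, K (t, y) ∈ U) (hV : ∀ t, ∀ y ∈ V, K (t, y) ∈ V)
    (h1 : ∀ y ∈ U, K (1, y) ∈ V) :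
    IsHomotopyEquivalence (ContinuousMap.inclusion hVU) := by
  let g : C(U, V) := ⟨fun y => ⟨K (1, y), h1 y y.2⟩, by fun_prop⟩
  refine ⟨⟨ContinuousMap.inclusion hVU, g, ?_, ?_⟩, rfl⟩
  · refine ContinuousMap.Homotopic.symm ⟨⟨⟨fun q => ⟨K (q.1, q.2), hV q.1 q.2 q.2.2⟩,
      by fun_prop⟩, fun y => Subtype.ext (h0 y), fun y => rfl⟩⟩
  · refine ContinuousMap.Homotopic.symm ⟨⟨⟨fun q => ⟨K (q.1, q.2), hU q.1 q.2 q.2.2⟩,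
      by fun_prop⟩, fun y => Subtype.ext (h0 y), fun y => rfl⟩⟩

theorem OnePoint.isZCompactification_of_homotopy {X : Type*} [TopologicalSpace X] [T2Space X]
    [LocallyCompactSpace X] [NoncompactSpace X]
    {h : X → ℝ} (h1 : ∀ x, h x < 1) (hc : Continuous fun y : OnePoint X => y.elim 1 h)
    {G : I × X → X} (hG : Continuous G) (hG0 : ∀ x, G (0, x) = x)
    {γ : I → X} (hγ : ContinuousOn γ {t | 0 < t})
    (hGγ : ∀ (t : I) x, 0 < t → 1 - (t : ℝ) ≤ h x → G (t, x) = γ t)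
    (hlow : ∀ (t : I) x, G (t, x) = x ∨ 1 - 2 * (t : ℝ) ≤ h (G (t, x)))
    (hγlow : ∀ t : I, 0 < t → 1 - 2 * (t : ℝ) ≤ h (γ t)) :
    IsZCompactification (fun x : X => (x : OnePoint X)) := by
  refine ⟨⟨inferInstance, inferInstance, isDenseEmbedding_coe⟩, fun U hU => ?_⟩
  by_cases hinf : (∞ : OnePoint X) ∈ U
  · obtain ⟨a, ha, haU⟩ := exists_superlevel_subset h1 hc hU hinf
    obtain ⟨ε, hε, haε⟩ : ∃ ε : I, 0 < ε ∧ a < 1 - 2 * (ε : ℝ) := by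
      have hm : 0 < min 1 ((1 - a) / 3) := lt_min one_pos (by linarith)
      refine ⟨⟨min 1 ((1 - a) / 3), hm.le, min_le_left _ _⟩, hm, ?_⟩
      have := min_le_right 1 ((1 - a) / 3)
      simp only
      linarith
    have hle (t : I) : a < 1 - 2 * ((ε * t : I) : ℝ) := by
      have : ((ε * t : I) : ℝ) ≤ ε := unitInterval.mul_le_left
      linarith
    have hGU (t : I) (x : X) (hx : (x : OnePoint X) ∈ U) : (G (ε * t, x) : OnePoint X) ∈ U := by
      obtain e | e := hlow (ε * t) x
      · rwa [e]
      · exact haU _ ((hle t).trans_le e)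
    have hγU (t : I) (ht : ε * t ≠ 0) : (γ (ε * t) : OnePoint X) ∈ U :=
      haU _ ((hle t).trans_le (hγlow _ (unitInterval.pos_iff_ne_zero.2 ht)))
    refine isHomotopyEquivalence_inclusion_of_homotopy _
      (fun q => extendHomotopy G γ (ε * q.1, q.2)) ?_ ?_ ?_ ?_ ?_
    · exact (continuous_extendHomotopy h1 hc hG hγ hGγ hlow hγlow).comp (by fun_prop)
    · intro y
      induction y using OnePoint.rec <;> simp [extendHomotopy, hG0]
    · intro t y hy
      induction y using OnePoint.rec with
      | infty =>
        by_cases ht : ε * t = 0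
        · simpa [extendHomotopy, ht] using hinf
        · simpa only [extendHomotopy, elim_infty, if_neg ht] using hγU t ht
      | coe x => exact hGU t x hy
    · rintro t y ⟨hy, hyr⟩
      obtain ⟨x, rfl⟩ := not_not.1 hyr
      exact ⟨hGU t x hy, not_not.2 ⟨_, rfl⟩⟩
    · intro y hy
      induction y using OnePoint.rec with
      | infty =>
        have ht : ε * 1 ≠ 0 := by simpa using hε.ne'
        simp only [extendHomotopy, elim_infty, if_neg ht]
        exact ⟨hγU 1 ht, not_not.2 ⟨_, rfl⟩⟩
      | coe x => exact ⟨hGU 1 x hy, not_not.2 ⟨_, rfl⟩⟩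
  · refine isHomotopyEquivalence_inclusion_of_homotopy _ Prod.snd continuous_snd (fun _ => rfl)
      (fun _ _ hy => hy) (fun _ _ hy => hy) fun y hy => ⟨hy, not_not.2 ?_⟩
    exact ne_infty_iff_exists.1 fun e => hinf (e ▸ hy)

/-- A contraction of `M` and a proper function `r` on `M` give a homotopy of `M × [0, 1)` that at
time `t` collapses `{max s (r x) ≥ 1 - t}` to a point at level `1 - t`: points near infinity are
moved to level `1 - t` first and then contracted there. -/
theorem exists_homotopy_collapsing_end {M : Type*} [TopologicalSpace M] {r : M → ℝ}
    (hr : Continuous r) (hr1 : ∀ x, r x < 1) {F : I × M → M} (hF : Continuous F)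
    (hF0 : ∀ x, F (0, x) = x) {p : M} (hF1 : ∀ x, F (1, x) = p) :
    ∃ G : I × (M × Ico (0 : ℝ) 1) → M × Ico (0 : ℝ) 1, Continuous G ∧ (∀ z, G (0, z) = z) ∧
      (∀ (t : I) z, 0 < t → 1 - (t : ℝ) ≤ max (z.2 : ℝ) (r z.1) →
        (G (t, z)).1 = p ∧ ((G (t, z)).2 : ℝ) = 1 - t) ∧
      ∀ (t : I) z, G (t, z) = z ∨
        1 - 2 * (t : ℝ) ≤ max ((G (t, z)).2 : ℝ) (r (G (t, z)).1) := by
  let h : M × Ico (0 : ℝ) 1 → ℝ := fun z => max (z.2 : ℝ) (r z.1)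
  have hh : Continuous h := by fun_prop
  have hh1 (z) : h z < 1 := max_lt z.2.2.2 (hr1 _)
  let τ : I × (M × Ico (0 : ℝ) 1) → ℝ := fun q =>
    4 * (h q.2 - 1 + 2 * (q.1 : ℝ)) / ((q.1 : ℝ) + (1 - h q.2))
  have hden (q : I × (M × Ico (0 : ℝ) 1)) : 0 < (q.1 : ℝ) + (1 - h q.2) := by
    have := hh1 q.2
    have := q.1.2.1
    linarith
  have hτ : Continuous τ := Continuous.div (by fun_prop) (by fun_prop) fun q => (hden q).ne'
  have hτ0 (q) (hq : h q.2 ≤ 1 - 2 * (q.1 : ℝ)) : τ q ≤ 0 :=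
    div_nonpos_of_nonpos_of_nonneg (by linarith) (hden q).le
  have hτ2 (q) (hq : 1 - (q.1 : ℝ) ≤ h q.2) : 2 ≤ τ q := by
    rw [le_div_iff₀ (hden q)]
    linarith
  let α : I × (M × Ico (0 : ℝ) 1) → I := fun q => projIcc 0 1 zero_le_one (τ q)
  let β : I × (M × Ico (0 : ℝ) 1) → I := fun q => projIcc 0 1 zero_le_one (τ q - 1)
  have hα : Continuous α := continuous_projIcc.comp hτ
  have hβ : Continuous β := continuous_projIcc.comp (by fun_prop)
  have hα0 (q) (hq : τ q ≤ 0) : α q = 0 := projIcc_of_le_left _ hq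
  have hβ0 (q) (hq : τ q ≤ 1) : β q = 0 := projIcc_of_le_left _ (by linarith)
  have hα1 (q) (hq : 1 ≤ τ q) : α q = 1 := projIcc_of_right_le _ hq
  have hβ1 (q) (hq : 2 ≤ τ q) : β q = 1 := projIcc_of_right_le _ (by linarith)
  let ℓ : I × (M × Ico (0 : ℝ) 1) → ℝ := fun q =>
    (1 - (α q : ℝ)) * (q.2.2 : ℝ) + (α q : ℝ) * (1 - (q.1 : ℝ))
  have hℓ : Continuous ℓ := by fun_prop
  have hℓ0 (q) (hq : τ q ≤ 0) : ℓ q = q.2.2 := by simp [ℓ, hα0 q hq]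
  have hℓ1 (q) (hq : 1 ≤ τ q) : ℓ q = 1 - q.1 := by simp [ℓ, hα1 q hq]
  have hℓmem (q) : ℓ q ∈ Ico (0 : ℝ) 1 := by
    obtain ht | ht := q.1.2.1.eq_or_lt
    · rw [hℓ0 q (hτ0 q (by rw [← ht]; linarith [hh1 q.2]))]
      exact q.2.2.2
    · exact convex_Ico (0 : ℝ) 1 q.2.2.2 ⟨sub_nonneg.2 q.1.2.2, by linarith⟩
        (sub_nonneg.2 (α q).2.2) (α q).2.1 (by ring)
  refine ⟨fun q => (F (β q, q.2.1), ⟨ℓ q, hℓmem q⟩), by fun_prop, fun z => ?_, ?_, ?_⟩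
  · have hq : τ (0, z) ≤ 0 := hτ0 _ (by simpa using (hh1 z).le)
    exact Prod.ext (by simp [hβ0 _ (hq.trans zero_le_one), hF0]) (Subtype.ext (hℓ0 _ hq))
  · intro t z _ hz
    have hq := hτ2 (t, z) hz
    exact ⟨by simp [hβ1 _ hq, hF1], hℓ1 _ (by linarith)⟩
  · intro t z
    obtain hz | hz := le_total (h z) (1 - 2 * (t : ℝ))
    · have hq : τ (t, z) ≤ 0 := hτ0 _ hz
      exact .inl (Prod.ext (by simp [hβ0 _ (hq.trans zero_le_one), hF0])
        (Subtype.ext (hℓ0 _ hq)))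
    · right
      obtain hq | hq := le_total (τ (t, z)) 1
      · simp only [hβ0 _ hq, hF0]
        obtain hs | hs := le_max_iff.1 hz
        · refine le_max_of_le_left (convex_Ici (1 - 2 * (t : ℝ)) hs ?_
            (sub_nonneg.2 (α (t, z)).2.2) (α (t, z)).2.1 (by ring))
          change 1 - 2 * (t : ℝ) ≤ 1 - t
          linarith [t.2.1]
        · exact le_max_of_le_right hs
      · refine le_max_of_le_left ?_
        simp only [hℓ1 _ hq]
        linarith [t.2.1]

theorem mainTheorem3 (n : ℕ) (M : Type*) [TopologicalSpace M]
    [ChartedSpace (EuclideanSpace ℝ (Fin n)) M] [T2Space M] [SecondCountableTopology M]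
    [NoncompactSpace M] [ContractibleSpace M] :
    IsZCompactification
      (fun x : M × Set.Ico (0 : ℝ) 1 => (x : OnePoint (M × Set.Ico (0 : ℝ) 1))) := by
  have : LocallyCompactSpace M := ChartedSpace.locallyCompactSpace (EuclideanSpace ℝ (Fin n)) M
  have : LocallyCompactSpace (Ico (0 : ℝ) 1) := isLocallyClosed_Ico.locallyCompactSpace
  have : Nonempty (Ico (0 : ℝ) 1) := ⟨⟨0, by simp⟩⟩
  obtain ⟨p, ⟨F⟩⟩ := id_nullhomotopic M
  obtain ⟨r, hr1, hrK⟩ := exists_continuous_lt_one_isCompact_sublevel M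
  obtain ⟨G, hG, hG0, hGγ, hlow⟩ := exists_homotopy_collapsing_end r.continuous hr1
    F.continuous F.map_zero_left F.map_one_left
  let h : M × Ico (0 : ℝ) 1 → ℝ := fun z => max (z.2 : ℝ) (r z.1)
  have hh : Continuous h := by fun_prop
  have hh1 (z) : h z < 1 := max_lt z.2.2.2 (hr1 _)
  have hhK (a : ℝ) (ha : a < 1) : IsCompact {z | h z ≤ a} := by
    have hI : IsCompact {s : Ico (0 : ℝ) 1 | (s : ℝ) ≤ a} := by
      rw [Topology.IsInducing.subtypeVal.isCompact_iff]
      convert! isCompact_Icc (a := (0 : ℝ)) (b := a)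
      ext s
      simp only [mem_image, mem_ofPred_eq, Subtype.exists, mem_Ico, mem_Icc]
      exact ⟨fun ⟨_, hs, h, e⟩ => e ▸ ⟨hs.1, h⟩, fun hs => ⟨s, ⟨hs.1, hs.2.trans_lt ha⟩, hs.2, rfl⟩⟩
    convert! (hrK a ha).prod hI
    ext z
    simp [h, and_comm]
  let γ : I → M × Ico (0 : ℝ) 1 := fun t =>
    (p, ⟨if 0 < t then 1 - (t : ℝ) else 0, by
      split_ifs with ht
      · exact ⟨sub_nonneg.2 t.2.2, sub_lt_self _ ht⟩
      · simp⟩)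
  have hγ (t : I) (ht : 0 < t) : ((γ t).2 : ℝ) = 1 - t := if_pos ht
  refine OnePoint.isZCompactification_of_homotopy hh1 (OnePoint.continuous_elim_one hh hh1 hhK)
    hG hG0 (γ := γ) ?_ (fun t z ht hz => ?_) hlow fun t ht => le_max_of_le_left ?_
  · refine continuousOn_const.prodMk (Topology.IsInducing.subtypeVal.continuousOn_iff.2 ?_)
    exact ContinuousOn.congr (f := fun t : I => 1 - (t : ℝ)) (by fun_prop) hγ
  · obtain ⟨e1, e2⟩ := hGγ t z ht hz
    exact Prod.ext e1 (Subtype.ext (e2.trans (hγ t ht).symm))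
  · rw [hγ t ht]
    linarith [t.2.1]
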